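/- Let $G$ be a finite simple graph that is cubic (every vertex has degree $3$) and bridgeless (no edge $e=uv$ of $G$ is a bridge, i.e. $u$ and $v$ remain connected in $G-e$); $G$ need not be connected. Then the line graph $L(G)$ is symmetric with respect to graph entropy, i.e. the uniform distribution $U$ on the vertices of $L(G)$ (the edges of $G$) satisfies \[ H_k(L(G),P)\le H_k(L(G),U)\qquad\text{for every probability distribution } P \text{ on } V(L(G)). \] Here, for a finite graph $F$ and a probability distribution $P=(p_v)_{v\in V(F)}$ on its vertices, the entropy of $F$ with respect to $P$ is \[ H_k(F,P)=\min_{\mathbf a\in VP(F)}\ \sum_{v\in V(F)}p_v\log_2\frac1{a_v}, \] where the vertex packing polytope $VP(F)\subseteq\mathbb R^{V(F)}$ is the convex hull of the characteristic vectors of the independent sets of $F$, with the conventions $\log_2(1/0)=+\infty$ and $0\cdot\infty=0$. -/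

import Mathlib

open scoped ENNReal

namespace GraphEntropy

/-- The vertex packing polytope of a graph: the convex hull of the characteristic vectors of its
independent sets of vertices. -/
def vertexPackingPolytope {W : Type*} (G : SimpleGraph W) : Set (W → ℝ) :=
  convexHull ℝ {a | ∃ S : Set W, G.IsIndepSet S ∧ a = S.indicator 1}

/-- `log₂ (1 / t)` for `t ∈ [0, 1]`, with the value `∞` at `t = 0`. -/
noncomputable def logInv (t : ℝ) : ℝ≥0∞ :=
  if t = 0 then ∞ else ENNReal.ofReal (Real.logb 2 (1 / t))

/-- The entropy `min_{a ∈ VP(G)} ∑ v, P v * log₂ (1 / a v)` of `G` with respect to `P`.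
The sum is taken in `[0, ∞]`, where `0 * ∞ = 0`; vectors in the vertex packing polytope have
coordinates in `[0, 1]`, so that every summand is the usual one. -/
noncomputable def entropy {W : Type*} [Fintype W] (G : SimpleGraph W) (P : W → ℝ) : ℝ≥0∞ :=
  ⨅ a ∈ vertexPackingPolytope G, ∑ v, ENNReal.ofReal (P v) * logInv (a v)

/-- The uniform distribution on a finite set. -/
noncomputable def uniform (W : Type*) [Fintype W] : W → ℝ :=
  fun _ => 1 / (Fintype.card W : ℝ)

/-- A graph is symmetric with respect to graph entropy if, among all probability distributions on
its vertices, the uniform one maximizes the entropy of the graph. -/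
def IsSymmetric {W : Type*} [Fintype W] (G : SimpleGraph W) : Prop :=
  IsMaxOn (entropy G) (stdSimplex ℝ W) (uniform W)

/-- No edge of the graph is a bridge. (`SimpleGraph.IsBridge` alone does not ask that its argument
be an edge.) -/
def Bridgeless {V : Type*} (G : SimpleGraph V) : Prop :=
  ∀ e ∈ G.edgeSet, ¬ G.IsBridge e

end GraphEntropy

/-!
The uniform distribution is shown to be extremal by exhibiting one point of the vertex packing
polytope of `L(G)` that is good for every distribution: the constant vector `1 / 3`. If it belongs
to the polytope, then `H(L(G), P) ≤ log₂ 3` for every `P` (`entropy_le_of_const_mem`). Conversely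
an independent set of `L(G)` is a matching of `G`, so it has at most `|V| / 2 = |E| / 3` elements;
hence the coordinates of every point of the polytope have mean at most `1 / 3`, and
`H(L(G), U) ≥ log₂ 3` by Jensen's inequality (`le_entropy_uniform`).

That the constant vector `1 / 3` is a convex combination of perfect matchings is an instance of
Edmonds' perfect matching polytope theorem (`Multigraph.oddCutPolytope_subset_convexHull`): in a
cubic graph every odd cut has an odd number of edges, and it cannot consist of a single one if
there are no bridges, so the vector satisfies all odd cut constraints
(`const_third_mem_oddCutPolytope`).

Edmonds' theorem is proved for multigraphs, by induction on the number of vertices. By the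
Krein–Milman theorem it is enough to treat extreme points `x` of the polytope of odd cut
constraints. If some odd cut with at least three vertices on each side is tight at `x`, both of its
shores are contracted in turn, and the convex combinations given by induction are glued along the
edges of the cut (`Multigraph.mem_convexHull_of_collapse`). Otherwise Tutte's theorem yields a
perfect matching `m` in the support of `x` (`Multigraph.exists_perfectMatching_le_support`); as no
further constraint is tight, a short segment in the direction `x - m` around `x` stays in the
polytope, so that `x = m` by extremality.
-/

namespace GraphEntropy

open Finset

/-! ### Multigraphs and their odd cuts -/

/-- A multigraph on the vertex type `V` with edges labelled by `E`. Parallel edges and loops are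
allowed, so that contracting vertices does not change the edge type. The orientation of the edges
is an artefact of the encoding. -/
structure Multigraph (V E : Type*) where
  /-- One end of an edge. -/
  src : E → V
  /-- The other end of an edge. -/
  tgt : E → V

namespace Multigraph

variable {V W E : Type*} [Fintype E]

/-- The image of a multigraph under a map of vertices; edges whose ends are identified become
loops. -/
def map (H : Multigraph V E) (π : V → W) : Multigraph W E where
  src e := π (H.src e)
  tgt e := π (H.tgt e)

open Classical in
/-- The edges with exactly one end in `S`. -/
noncomputable def cut (H : Multigraph V E) (S : Finset V) : Finset E :=
  {e | ¬(H.src e ∈ S ↔ H.tgt e ∈ S)}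

/-- Edmonds' description of the perfect matching polytope: the nonnegative edge weights, zero on
loops, with total weight one at every vertex and at least one on every odd cut. -/
def oddCutPolytope (H : Multigraph V E) : Set (E → ℝ) :=
  {x | (∀ e, 0 ≤ x e) ∧ (∀ e, H.src e = H.tgt e → x e = 0) ∧
    (∀ v, ∑ e ∈ H.cut {v}, x e = 1) ∧ ∀ S : Finset V, Odd #S → 1 ≤ ∑ e ∈ H.cut S, x e}

/-- The characteristic vectors of the perfect matchings. -/
def perfectMatchings (H : Multigraph V E) : Set (E → ℝ) :=
  {m | (∀ e, m e = 0 ∨ m e = 1) ∧ (∀ e, H.src e = H.tgt e → m e = 0) ∧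
    ∀ v, ∑ e ∈ H.cut {v}, m e = 1}

@[simp]
lemma mem_cut {H : Multigraph V E} {S : Finset V} {e : E} :
    e ∈ H.cut S ↔ ¬(H.src e ∈ S ↔ H.tgt e ∈ S) := by
  simp [cut]

lemma cut_compl [Fintype V] [DecidableEq V] (H : Multigraph V E) (S : Finset V) :
    H.cut Sᶜ = H.cut S := by
  ext e; simp [not_iff_not]

lemma cut_map [Fintype V] [DecidableEq W] (H : Multigraph V E) (π : V → W) (T : Finset W) :
    (H.map π).cut T = H.cut {v | π v ∈ T} := by
  ext e; simp [map]

lemma finite_perfectMatchings (H : Multigraph V E) : H.perfectMatchings.Finite := by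
  classical
  refine (Set.Finite.pi' (ι := E) (t := fun _ => ({0, 1} : Set ℝ))
    fun _ => Set.toFinite _).subset fun m hm e => ?_
  simpa using hm.1 e

lemma le_one_of_mem_oddCutPolytope {H : Multigraph V E} {x : E → ℝ} (hx : x ∈ H.oddCutPolytope)
    (e : E) : x e ≤ 1 := by
  by_cases h : H.src e = H.tgt e
  · simp [hx.2.1 e h]
  · rw [← hx.2.2.1 (H.src e)]
    exact single_le_sum (f := x) (fun i _ => hx.1 i) (by simp [Ne.symm h])

lemma convex_oddCutPolytope (H : Multigraph V E) : Convex ℝ H.oddCutPolytope := by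
  intro x hx y hy a b ha hb hab
  have key (S : Finset V) : ∑ e ∈ H.cut S, (a • x + b • y) e
      = a * ∑ e ∈ H.cut S, x e + b * ∑ e ∈ H.cut S, y e := by
    simp [sum_add_distrib, mul_sum]
  refine ⟨fun e => ?_, fun e he => ?_, fun v => ?_, fun S hS => ?_⟩
  · have := hx.1 e
    have := hy.1 e
    simp only [Pi.add_apply, Pi.smul_apply, smul_eq_mul]
    positivity
  · simp [hx.2.1 e he, hy.2.1 e he]
  · rw [key, hx.2.2.1, hy.2.2.1]; linarith
  · rw [key]
    nlinarith [hx.2.2.2 S hS, hy.2.2.2 S hS]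

lemma isCompact_oddCutPolytope (H : Multigraph V E) : IsCompact H.oddCutPolytope := by
  refine (isCompact_Icc (a := (0 : E → ℝ)) (b := 1)).of_isClosed_subset ?_ fun x hx =>
    ⟨hx.1, le_one_of_mem_oddCutPolytope hx⟩
  simp only [oddCutPolytope, Set.ofPred_and, Set.ofPred_forall]
  refine .inter (isClosed_iInter fun e => isClosed_le (by fun_prop) (by fun_prop)) <|
    .inter (isClosed_iInter fun e => isClosed_iInter fun _ => isClosed_eq (by fun_prop)
      (by fun_prop)) <|
    .inter (isClosed_iInter fun v => isClosed_eq (by fun_prop) (by fun_prop)) <|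
    isClosed_iInter fun S => isClosed_iInter fun _ => isClosed_le (by fun_prop) (by fun_prop)

lemma even_card_of_mem_oddCutPolytope [Fintype V] {H : Multigraph V E} {x : E → ℝ}
    (hx : x ∈ H.oddCutPolytope) : Even (Fintype.card V) := by
  by_contra h
  have := hx.2.2.2 univ (by simpa using h)
  have h0 : H.cut univ = ∅ := by ext e; simp
  rw [h0, sum_empty] at this
  linarith

/-! ### Contracting the two shores of a tight odd cut -/

open Classical in
/-- The oddness of the fibres makes the preimage of an odd vertex set odd. -/
lemma map_mem_oddCutPolytope [Fintype V] {H : Multigraph V E} {x : E → ℝ}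
    (hx : x ∈ H.oddCutPolytope) (π : V → W) (hodd : ∀ p, Odd #{v | π v = p})
    (hone : ∀ p, ∑ e ∈ H.cut {v | π v = p}, x e = 1) :
    (fun e => if π (H.src e) = π (H.tgt e) then 0 else x e) ∈ (H.map π).oddCutPolytope := by
  have key (T : Finset W) : ∑ e ∈ (H.map π).cut T,
      (if π (H.src e) = π (H.tgt e) then 0 else x e) = ∑ e ∈ H.cut {v | π v ∈ T}, x e := by
    rw [cut_map]
    refine sum_congr rfl fun e he => if_neg fun h => ?_
    simp [h] at he
  refine ⟨fun e => ?_, fun e he => if_pos he, fun p => ?_, fun T hT => ?_⟩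
  · dsimp only
    split_ifs
    exacts [le_rfl, hx.1 e]
  · rw [key]; simpa using hone p
  · rw [key]
    refine hx.2.2.2 _ ?_
    rw [card_eq_sum_card_fiberwise (f := π) (t := T) (fun v hv => by simpa using hv),
      odd_sum_iff_odd_card_odd]
    convert hT using 2
    refine filter_true_of_mem fun p hp => ?_
    convert hodd p using 2
    ext v
    simp only [mem_filter, mem_univ, true_and, and_iff_right_iff_imp]
    rintro rfl
    exact hp

/-- The map contracting all vertices outside `S` to a single one. -/
def collapse [DecidableEq V] (S : Finset V) (v : V) : Option S :=
  if h : v ∈ S then some ⟨v, h⟩ else none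

section collapse

variable [DecidableEq V] {S : Finset V}

@[simp]
lemma collapse_eq_some {v : V} {w : S} : collapse S v = some w ↔ v = w := by
  unfold collapse
  split_ifs with h
  · simp [Subtype.ext_iff]
  · simp only [false_iff]
    rintro rfl
    exact h w.2

@[simp]
lemma collapse_eq_none {v : V} : collapse S v = none ↔ v ∉ S := by
  unfold collapse
  split_ifs with h <;> simp [h]

lemma collapse_eq_collapse {v w : V} :
    collapse S v = collapse S w ↔ v = w ∨ (v ∉ S ∧ w ∉ S) := by
  unfold collapse
  split_ifs with h h' h' <;> simp [h, h'] <;> rintro rfl <;> contradiction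

variable [Fintype V]

lemma cut_map_collapse_some (H : Multigraph V E) (v : S) :
    (H.map (collapse S)).cut {some v} = H.cut {(v : V)} := by
  rw [cut_map]; congr 1; ext; simp

lemma cut_map_collapse_none (H : Multigraph V E) :
    (H.map (collapse S)).cut {none} = H.cut S := by
  rw [cut_map, ← cut_compl]; congr 1; ext; simp

lemma map_collapse_mem_oddCutPolytope {H : Multigraph V E} {x : E → ℝ}
    (hx : x ∈ H.oddCutPolytope) (hodd : Odd #Sᶜ) (hone : ∑ e ∈ H.cut S, x e = 1) :
    (fun e => if collapse S (H.src e) = collapse S (H.tgt e) then 0 else x e) ∈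
      (H.map (collapse S)).oddCutPolytope := by
  convert map_mem_oddCutPolytope hx (collapse S) ?_ ?_ using 3
  · rintro (_ | v)
    · convert hodd using 2
      ext; simp
    · simp [filter_eq']
  · rintro (_ | v)
    · rw [← hone, ← cut_compl]
      congr 2; ext; simp
    · rw [← hx.2.2.1 v]
      congr 2; ext; simp

end collapse

/-! ### Gluing matchings along a tight cut -/

/-- Two finite distributions whose members carry colour vectors with the same mean can be coupled
so that coupled members have a colour in common. -/
lemma exists_coupling {ι κ α : Type*} [Fintype ι] [Fintype κ] (C : Finset α) {p : ι → ℝ} {q : κ → ℝ}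
    {a : ι → α → ℝ} {b : κ → α → ℝ} {x : α → ℝ} (hp : ∀ i, 0 ≤ p i) (hq : ∀ j, 0 ≤ q j)
    (ha : ∀ i e, 0 ≤ a i e) (hb : ∀ j e, 0 ≤ b j e) (ha1 : ∀ i, ∑ e ∈ C, a i e = 1)
    (hb1 : ∀ j, ∑ e ∈ C, b j e = 1) (hpa : ∀ e ∈ C, ∑ i, p i * a i e = x e)
    (hqb : ∀ e ∈ C, ∑ j, q j * b j e = x e) :
    ∃ r : ι → κ → ℝ, (∀ i j, 0 ≤ r i j) ∧ (∀ i, ∑ j, r i j = p i) ∧ (∀ j, ∑ i, r i j = q j) ∧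
      ∀ i j, r i j ≠ 0 → ∃ e ∈ C, a i e ≠ 0 ∧ b j e ≠ 0 := by
  have hx : ∀ e ∈ C, 0 ≤ x e := fun e he =>
    hpa e he ▸ sum_nonneg fun i _ => mul_nonneg (hp i) (ha i e)
  refine ⟨fun i j => ∑ e ∈ C, p i * a i e * (q j * b j e) / x e, fun i j => ?_, fun i => ?_,
    fun j => ?_, fun i j h => ?_⟩
  · exact sum_nonneg fun e he => div_nonneg (mul_nonneg (mul_nonneg (hp i) (ha i e))
      (mul_nonneg (hq j) (hb j e))) (hx e he)
  · rw [sum_comm]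
    calc _ = ∑ e ∈ C, p i * a i e := sum_congr rfl fun e he => ?_
      _ = p i := by rw [← mul_sum, ha1, mul_one]
    rw [← sum_div, ← mul_sum, hqb e he]
    rcases eq_or_ne (x e) 0 with h0 | h0
    -- Where `x e = 0` the quotient is junk, but then no member charges `e`.
    · have := (sum_eq_zero_iff_of_nonneg fun i _ => mul_nonneg (hp i) (ha i e)).1
        ((hpa e he).trans h0) i (mem_univ i)
      simp [this]
    · field_simp
  · rw [sum_comm]
    calc _ = ∑ e ∈ C, q j * b j e := sum_congr rfl fun e he => ?_
      _ = q j := by rw [← mul_sum, hb1, mul_one]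
    rw [← sum_div, ← sum_mul, hpa e he]
    rcases eq_or_ne (x e) 0 with h0 | h0
    · have := (sum_eq_zero_iff_of_nonneg fun i _ => mul_nonneg (hq i) (hb i e)).1
        ((hqb e he).trans h0) j (mem_univ j)
      simp [this]
    · field_simp
  · obtain ⟨e, he, hne⟩ := exists_ne_zero_of_sum_ne_zero h
    exact ⟨e, he, fun h0 => hne (by simp [h0]), fun h0 => hne (by simp [h0])⟩

/-- A `0`-`1` vector of total one on `C` vanishes at all but one element of `C`. -/
lemma eq_zero_of_sum_eq_one {α : Type*} {C : Finset α} {m : α → ℝ} (h01 : ∀ e, m e = 0 ∨ m e = 1)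
    (hsum : ∑ e ∈ C, m e = 1) {e f : α} (he : e ∈ C) (hf : f ∈ C) (hme : m e ≠ 0) (hef : f ≠ e) :
    m f = 0 := by
  classical
  have h0 : ∀ g, 0 ≤ m g := fun g => by rcases h01 g with h | h <;> simp [h]
  have h1 := (h01 e).resolve_left hme
  have := sum_le_sum_of_subset_of_nonneg (s := {e, f}) (t := C) (f := m)
    (by simp [insert_subset_iff, he, hf]) (fun g _ _ => h0 g)
  rw [sum_pair hef.symm, hsum, h1] at this
  linarith [h0 f]

open Classical in
/-- Perfect matchings of the two contractions along `S` that share an edge of the cut form a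
perfect matching together. -/
lemma glue_mem_perfectMatchings [Fintype V] {H : Multigraph V E} {S : Finset V} {m n : E → ℝ}
    (hm : m ∈ (H.map (collapse S)).perfectMatchings)
    (hn : n ∈ (H.map (collapse Sᶜ)).perfectMatchings)
    (h : ∃ e ∈ H.cut S, m e ≠ 0 ∧ n e ≠ 0) :
    (fun e => if H.src e ∈ S ∨ H.tgt e ∈ S then m e else n e) ∈ H.perfectMatchings := by
  obtain ⟨hm01, hml, hm1⟩ := hm
  obtain ⟨hn01, hnl, hn1⟩ := hn
  have hmS : ∑ e ∈ H.cut S, m e = 1 := by rw [← hm1 none, cut_map_collapse_none]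
  have hnS : ∑ e ∈ H.cut S, n e = 1 := by rw [← hn1 none, cut_map_collapse_none, cut_compl]
  have hmn : ∀ f ∈ H.cut S, m f = n f := by
    obtain ⟨e, he, hme, hne⟩ := h
    intro f hf
    by_cases hfe : f = e
    · rw [hfe, (hm01 e).resolve_left hme, (hn01 e).resolve_left hne]
    · rw [eq_zero_of_sum_eq_one hm01 hmS he hf hme hfe,
        eq_zero_of_sum_eq_one hn01 hnS he hf hne hfe]
  refine ⟨fun e => ?_, fun e he => ?_, fun v => ?_⟩
  · dsimp only
    split_ifs
    exacts [hm01 e, hn01 e]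
  · dsimp only
    split_ifs
    exacts [hml e (congrArg (collapse S) he), hnl e (congrArg (collapse Sᶜ) he)]
  · by_cases hv : v ∈ S
    · rw [← hm1 (some ⟨v, hv⟩), cut_map_collapse_some]
      refine sum_congr rfl fun e he => if_pos ?_
      by_contra! hc
      have h1 : H.src e ≠ v := fun h => hc.1 (h ▸ hv)
      have h2 : H.tgt e ≠ v := fun h => hc.2 (h ▸ hv)
      simp [h1, h2] at he
    · rw [← hn1 (some ⟨v, by simpa using hv⟩), cut_map_collapse_some]
      refine sum_congr rfl fun e he => ?_
      dsimp only
      split_ifs with hS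
      · refine hmn e ?_
        rw [mem_cut] at he ⊢
        simp only [mem_singleton] at he
        rintro hiff
        have h1 : H.src e ∈ S := by tauto
        have h2 : H.tgt e ∈ S := by tauto
        have h1 : H.src e ≠ v := fun h => hv (h ▸ h1)
        have h2 : H.tgt e ≠ v := fun h => hv (h ▸ h2)
        tauto
      · rfl

open Classical in
/-- If the cut of `S` is tight, convex combinations of perfect matchings of the two contractions
along `S` combine to one of perfect matchings of the whole multigraph. -/
lemma mem_convexHull_of_collapse [Fintype V] {H : Multigraph V E} {x : E → ℝ} {S : Finset V}
    (hx : x ∈ H.oddCutPolytope)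
    (h₁ : (fun e => if collapse S (H.src e) = collapse S (H.tgt e) then 0 else x e) ∈
      convexHull ℝ (H.map (collapse S)).perfectMatchings)
    (h₂ : (fun e => if collapse Sᶜ (H.src e) = collapse Sᶜ (H.tgt e) then 0 else x e) ∈
      convexHull ℝ (H.map (collapse Sᶜ)).perfectMatchings) :
    x ∈ convexHull ℝ H.perfectMatchings := by
  obtain ⟨ι, _, p, m, hp, hp1, hm, hpm⟩ := mem_convexHull_iff_exists_fintype.1 h₁
  obtain ⟨κ, _, q, n, hq, hq1, hn, hqn⟩ := mem_convexHull_iff_exists_fintype.1 h₂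
  have hpm (e : E) : ∑ i, p i * m i e =
      if collapse S (H.src e) = collapse S (H.tgt e) then 0 else x e := by
    simpa using congrFun hpm e
  have hqn (e : E) : ∑ j, q j * n j e =
      if collapse Sᶜ (H.src e) = collapse Sᶜ (H.tgt e) then 0 else x e := by
    simpa using congrFun hqn e
  have hnonneg {m : E → ℝ} (h : ∀ e, m e = 0 ∨ m e = 1) (e : E) : 0 ≤ m e := by
    rcases h e with h | h <;> simp [h]
  -- Away from the vertices merged by a contraction, its mean matching is `x`.
  have hpx (e : E) (he : H.src e ∈ S ∨ H.tgt e ∈ S) : ∑ i, p i * m i e = x e := by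
    rw [hpm, ite_eq_right_iff, collapse_eq_collapse]
    rintro (h | h)
    · exact (hx.2.1 e h).symm
    · tauto
  have hqx (e : E) (he : ¬(H.src e ∈ S ∧ H.tgt e ∈ S)) : ∑ j, q j * n j e = x e := by
    rw [hqn, ite_eq_right_iff, collapse_eq_collapse]
    rintro (h | h)
    · exact (hx.2.1 e h).symm
    · simp only [mem_compl, not_not] at h
      tauto
  obtain ⟨r, hr, hrp, hrq, hrmn⟩ := exists_coupling (x := x) (H.cut S) hp hq
    (fun i => hnonneg (hm i).1) (fun j => hnonneg (hn j).1)
    (fun i => by rw [← (hm i).2.2 none, cut_map_collapse_none])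
    (fun j => by rw [← (hn j).2.2 none, cut_map_collapse_none, cut_compl])
    (fun e he => hpx e (by rw [mem_cut] at he; tauto))
    (fun e he => hqx e (by rw [mem_cut] at he; tauto))
  let g : ι × κ → E → ℝ := fun ij e =>
    if H.src e ∈ S ∨ H.tgt e ∈ S then m ij.1 e else n ij.2 e
  have hsum : ∑ ij : ι × κ with r ij.1 ij.2 ≠ 0, r ij.1 ij.2 • g ij = x := by
    rw [sum_filter_of_ne fun ij _ h => left_ne_zero_of_smul h]
    ext e
    simp only [Fintype.sum_prod_type, Finset.sum_apply, Pi.smul_apply, smul_eq_mul, g]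
    split_ifs with he
    · simp_rw [← sum_mul, hrp, hpx e he]
    · rw [sum_comm]
      simp_rw [← sum_mul, hrq, hqx e (by tauto)]
  rw [← hsum]
  refine (convex_convexHull ℝ _).sum_mem (fun ij _ => hr _ _) ?_ fun ij hij => ?_
  · rw [sum_filter_of_ne fun ij _ h => h, Fintype.sum_prod_type]
    simp_rw [hrp, hp1]
  · exact subset_convexHull ℝ _ (glue_mem_perfectMatchings (hm _) (hn _)
      (hrmn _ _ (mem_filter.1 hij).2))

/-! ### Tutte's theorem on the support of a point of the polytope -/

/-- The simple graph of the pairs of vertices joined by an edge of positive weight. -/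
def supportGraph (H : Multigraph V E) (x : E → ℝ) : SimpleGraph V :=
  .fromEdgeSet {f | ∃ e, 0 < x e ∧ s(H.src e, H.tgt e) = f}

open Classical in
/-- Every odd component left by deleting `U` sends weight at least one to `U`, while the vertices
of `U` receive weight `#U` in total. -/
lemma not_isTutteViolator_supportGraph [Fintype V] {H : Multigraph V E} {x : E → ℝ}
    (hx : x ∈ H.oddCutPolytope) (U : Set V) : ¬(H.supportGraph x).IsTutteViolator U := by
  set K := H.supportGraph x with hK
  set D := ((⊤ : K.Subgraph).deleteVerts U).coe with hD
  have hadj (a b : ((⊤ : K.Subgraph).deleteVerts U).verts) (h : K.Adj a b) :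
      D.connectedComponentMk a = D.connectedComponentMk b := by
    refine SimpleGraph.ConnectedComponent.eq.2 (SimpleGraph.Adj.reachable ?_)
    have ha := a.2
    have hb := b.2
    simp only [SimpleGraph.Subgraph.deleteVerts_verts, SimpleGraph.Subgraph.verts_top,
      Set.mem_sdiff, Set.mem_univ, true_and] at ha hb
    simp [hD, ha, hb, h]
  have hverts (v : V) : v ∈ ((⊤ : K.Subgraph).deleteVerts U).verts ↔ v ∉ U := by simp
  let shore (C : D.ConnectedComponent) : Finset V :=
    {v | ∃ h : v ∈ ((⊤ : K.Subgraph).deleteVerts U).verts, D.connectedComponentMk ⟨v, h⟩ = C}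
  have hshore (C v) : v ∈ shore C ↔
      ∃ h : v ∈ ((⊤ : K.Subgraph).deleteVerts U).verts, D.connectedComponentMk ⟨v, h⟩ = C := by
    simp [shore]
  have hcard (C : D.ConnectedComponent) : #(shore C) = C.supp.ncard := by
    rw [← Set.ncard_image_of_injective _ Subtype.val_injective, ← Set.ncard_coe_finset]
    congr 1
    ext v
    simp [shore]
  -- A positive edge leaving a component ends in `U`, so it leaves no other component.
  have hedge (a b : V) (hK' : K.Adj a b) (C : D.ConnectedComponent) (haC : a ∈ shore C)
      (hbC : b ∉ shore C) : b ∈ U ∧ ∀ C', a ∈ shore C' ∨ b ∈ shore C' → C' = C := by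
    obtain ⟨ha, rfl⟩ := (hshore _ _).1 haC
    have hb : b ∈ U := by
      by_contra hb
      exact hbC ((hshore _ _).2 ⟨(hverts b).2 hb, (hadj ⟨a, ha⟩ ⟨b, (hverts b).2 hb⟩ hK').symm⟩)
    refine ⟨hb, fun C' hC' => ?_⟩
    rcases hC' with h | h
    · obtain ⟨_, rfl⟩ := (hshore _ _).1 h
      rfl
    · obtain ⟨h, -⟩ := (hshore _ _).1 h
      exact absurd hb ((hverts b).1 h)
  have hcount (e : E) (he : 0 < x e) :
      (#{C : D.ConnectedComponent | e ∈ H.cut (shore C)} : ℝ) ≤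
        #{u ∈ U.toFinset | e ∈ H.cut {u}} := by
    rcases Finset.eq_empty_or_nonempty {C : D.ConnectedComponent | e ∈ H.cut (shore C)} with h | h
    · rw [h]; simp
    obtain ⟨C, hC⟩ := h
    have hne : H.src e ≠ H.tgt e := fun h => he.ne' (hx.2.1 e h)
    have hKe : K.Adj (H.src e) (H.tgt e) := by
      rw [hK, supportGraph, SimpleGraph.fromEdgeSet_adj]
      exact ⟨⟨e, he, rfl⟩, hne⟩
    have key : ∃ b ∈ U, e ∈ H.cut {b} ∧
        ∀ C', H.src e ∈ shore C' ∨ H.tgt e ∈ shore C' → C' = C := by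
      simp only [mem_filter, mem_univ, true_and, mem_cut] at hC
      by_cases hs : H.src e ∈ shore C
      · obtain ⟨h1, h2⟩ := hedge _ _ hKe C hs (by tauto)
        exact ⟨_, h1, by simp [hne], h2⟩
      · obtain ⟨h1, h2⟩ := hedge _ _ hKe.symm C (by tauto) hs
        exact ⟨_, h1, by simp [hne.symm], fun C' h => h2 C' h.symm⟩
    obtain ⟨b, hbU, hbe, huniq⟩ := key
    have h1 : #{C : D.ConnectedComponent | e ∈ H.cut (shore C)} ≤ 1 := by
      have : Nonempty D.ConnectedComponent := ⟨C⟩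
      rw [card_le_one_iff_subset_singleton]
      refine ⟨C, fun C' hC' => mem_singleton.2 (huniq C' ?_)⟩
      simp only [mem_filter, mem_univ, true_and, mem_cut] at hC'
      tauto
    have h2 : 0 < #{u ∈ U.toFinset | e ∈ H.cut {u}} :=
      card_pos.2 ⟨b, by simpa [hbU] using hbe⟩
    exact_mod_cast h1.trans h2
  rw [SimpleGraph.IsTutteViolator, not_lt, Set.ncard_eq_toFinset_card',
    Set.ncard_eq_toFinset_card', ← Nat.cast_le (α := ℝ)]
  change ((#(D.oddComponents.toFinset) : ℕ) : ℝ) ≤ _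
  calc (#D.oddComponents.toFinset : ℝ)
      = ∑ C ∈ D.oddComponents.toFinset, (1 : ℝ) := by simp
    _ ≤ ∑ C ∈ D.oddComponents.toFinset, ∑ e ∈ H.cut (shore C), x e := by
        refine sum_le_sum fun C hC => hx.2.2.2 _ ?_
        rw [hcard]
        simpa using hC
    _ ≤ ∑ C : D.ConnectedComponent, ∑ e ∈ H.cut (shore C), x e :=
        sum_le_sum_of_subset_of_nonneg (subset_univ _)
          fun C _ _ => sum_nonneg fun e _ => hx.1 e
    _ = ∑ e, #{C : D.ConnectedComponent | e ∈ H.cut (shore C)} * x e := by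
        rw [sum_comm' (t' := univ) (s' := fun e => {C | e ∈ H.cut (shore C)}) (by simp)]
        simp
    _ ≤ ∑ e, #{u ∈ U.toFinset | e ∈ H.cut {u}} * x e := by
        refine sum_le_sum fun e _ => ?_
        rcases (hx.1 e).eq_or_lt with h | h
        · simp [← h]
        · exact mul_le_mul_of_nonneg_right (hcount e h) h.le
    _ = ∑ u ∈ U.toFinset, ∑ e ∈ H.cut {u}, x e := by
        rw [sum_comm' (s := U.toFinset) (t' := univ)
          (s' := fun e => {u ∈ U.toFinset | e ∈ H.cut {u}}) (by simp)]
        simp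
    _ = #U.toFinset := by simp [hx.2.2.1]

lemma exists_perfectMatching_le_support [Fintype V] {H : Multigraph V E} {x : E → ℝ}
    (hx : x ∈ H.oddCutPolytope) : ∃ m ∈ H.perfectMatchings, ∀ e, x e = 0 → m e = 0 := by
  classical
  obtain ⟨M, hM⟩ := SimpleGraph.tutte.2 (not_isTutteViolator_supportGraph hx)
  have hlift (f : M.edgeSet) : ∃ e, 0 < x e ∧ s(H.src e, H.tgt e) = f := by
    have := M.edgeSet_subset f.2
    simp only [supportGraph, SimpleGraph.edgeSet_fromEdgeSet] at this
    exact this.1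
  -- One of the parallel edges of the multigraph for every edge of the matching.
  choose c hc0 hc using hlift
  refine ⟨fun e => if e ∈ Set.range c then 1 else 0, ⟨fun e => ?_, fun e he => if_neg ?_,
    fun v => ?_⟩, fun e he => if_neg ?_⟩
  · dsimp only
    split_ifs <;> simp
  · rintro ⟨f, rfl⟩
    exact (hc0 f).ne' (hx.2.1 _ he)
  · obtain ⟨w, hvw, huniq⟩ := SimpleGraph.Subgraph.isPerfectMatching_iff.1 hM v
    have hends := hc ⟨s(v, w), hvw⟩
    have hcv : c ⟨s(v, w), hvw⟩ ∈ H.cut {v} := by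
      have hne := hvw.ne
      rw [Sym2.eq_iff] at hends
      rcases hends with ⟨h1, h2⟩ | ⟨h1, h2⟩ <;> simp [h1, h2, hne.symm]
    rw [sum_eq_single_of_mem _ hcv, if_pos ⟨_, rfl⟩]
    rintro e he hne
    refine if_neg ?_
    rintro ⟨⟨f, hf⟩, rfl⟩
    have hv : v ∈ f := by
      have hf' := hc ⟨f, hf⟩
      dsimp only at hf'
      rw [← hf', Sym2.mem_iff]
      simp only [mem_cut, mem_singleton] at he
      tauto
    obtain ⟨w', rfl⟩ := hv
    obtain rfl := huniq w' hf
    exact hne rfl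
  · rintro ⟨f, rfl⟩
    exact (hc0 f).ne' he

/-! ### Edmonds' perfect matching polytope theorem -/

/-- An extreme point `x` at which only the cuts of single vertices and of their complements are
tight is a perfect matching: if `m` is a perfect matching in its support, `x` is the midpoint of
`x ± δ (x - m)`. -/
lemma mem_perfectMatchings_of_mem_extremePoints [Fintype V] [DecidableEq V] {H : Multigraph V E}
    {x : E → ℝ} (hx : x ∈ H.oddCutPolytope.extremePoints ℝ)
    (htight : ∀ S : Finset V, Odd #S → ∑ e ∈ H.cut S, x e = 1 → #S = 1 ∨ #Sᶜ = 1) :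
    x ∈ H.perfectMatchings := by
  obtain ⟨hxQ, hext⟩ := mem_extremePoints_iff_left.1 hx
  obtain ⟨m, hm, hsupp⟩ := exists_perfectMatching_le_support hxQ
  have hlim (f : ℝ → ℝ) (hf : Continuous f) (h0 : 0 < f 0) : ∀ᶠ δ in nhds (0 : ℝ), 0 ≤ f δ :=
    (hf.tendsto 0).eventually (lt_mem_nhds h0) |>.mono fun _ h => h.le
  have hmem : ∀ᶠ δ in nhds (0 : ℝ), x + δ • (x - m) ∈ H.oddCutPolytope := by
    have hsum (δ : ℝ) (S : Finset V) : ∑ e ∈ H.cut S, (x + δ • (x - m)) e =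
        ∑ e ∈ H.cut S, x e + δ * (∑ e ∈ H.cut S, x e - ∑ e ∈ H.cut S, m e) := by
      simp [sum_add_distrib, mul_sum, sum_sub_distrib, mul_sub]
    have hnn : ∀ e, ∀ᶠ δ in nhds (0 : ℝ), 0 ≤ (x + δ • (x - m)) e := by
      intro e
      rcases (hxQ.1 e).eq_or_lt with h | h
      · simp [← h, hsupp e h.symm]
      · exact hlim _ (by simp only [Pi.add_apply, Pi.smul_apply]; fun_prop) (by simpa using h)
    have hcut : ∀ S : Finset V, ∀ᶠ δ in nhds (0 : ℝ), Odd #S →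
        1 ≤ ∑ e ∈ H.cut S, (x + δ • (x - m)) e := by
      intro S
      by_cases hS : Odd #S
      swap
      · simp [hS]
      rcases (hxQ.2.2.2 S hS).eq_or_lt with h | h
      · have hone : ∑ e ∈ H.cut S, m e = 1 := by
          rcases htight S hS h.symm with h1 | h1
          · obtain ⟨v, rfl⟩ := card_eq_one.1 h1
            exact hm.2.2 v
          · obtain ⟨v, hv⟩ := card_eq_one.1 h1
            rw [← cut_compl, hv]
            exact hm.2.2 v
        exact .of_forall fun δ _ => by rw [hsum, hone, ← h]; simp
      · filter_upwards [hlim (fun δ => ∑ e ∈ H.cut S, (x + δ • (x - m)) e - 1)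
          (by simp only [hsum]; fun_prop) (by simpa using h)] with δ hδ _
        linarith
    filter_upwards [Filter.eventually_all.2 hnn, Filter.eventually_all.2 hcut] with δ h1 h2
    refine ⟨h1, fun e he => by simp [hxQ.2.1 e he, hm.2.1 e he], fun v => ?_, h2⟩
    rw [hsum, hxQ.2.2.1, hm.2.2]
    simp
  obtain ⟨ε, hε, hball⟩ := Metric.eventually_nhds_iff.1 hmem
  have hseg := hext (x + (ε / 2) • (x - m)) (hball (by simp [abs_of_pos hε, hε]))
    (x + (-(ε / 2)) • (x - m)) (hball (by simp [abs_of_pos hε, hε]))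
    ⟨1 / 2, 1 / 2, by norm_num, by norm_num, by norm_num, by module⟩
  rw [add_eq_left, smul_eq_zero] at hseg
  rw [sub_eq_zero.1 (hseg.resolve_left (by positivity))]
  exact hm

/-- **Edmonds' perfect matching polytope theorem** for multigraphs. The induction is on the number
of vertices. -/
theorem oddCutPolytope_subset_convexHull [Fintype V] (H : Multigraph V E) :
    H.oddCutPolytope ⊆ convexHull ℝ H.perfectMatchings := by
  classical
  induction hn : Fintype.card V using Nat.strong_induction_on generalizing V with
  | _ n ih =>
    subst hn
    rw [← closure_convexHull_extremePoints H.isCompact_oddCutPolytope H.convex_oddCutPolytope]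
    refine closure_minimal (convexHull_min (fun x hx => ?_) (convex_convexHull ℝ _))
      (H.finite_perfectMatchings.isClosed_convexHull ℝ)
    by_cases htight : ∀ S : Finset V, Odd #S → ∑ e ∈ H.cut S, x e = 1 → #S = 1 ∨ #Sᶜ = 1
    · exact subset_convexHull ℝ _ (mem_perfectMatchings_of_mem_extremePoints hx htight)
    push Not at htight
    obtain ⟨S, hS, hone, hS1, hS1'⟩ := htight
    have hxQ := extremePoints_subset hx
    have hadd := card_add_card_compl S
    have hS' : Odd #Sᶜ := by
      have := even_card_of_mem_oddCutPolytope hxQ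
      rw [← hadd] at this
      grind
    have h3 : 3 ≤ #S := by grind
    have h3' : 3 ≤ #Sᶜ := by grind
    refine mem_convexHull_of_collapse (S := S) hxQ ?_ ?_
    · exact ih _ (by simp; omega) _ rfl (map_collapse_mem_oddCutPolytope hxQ hS' hone)
    · exact ih _ (by simp; omega) _ rfl (map_collapse_mem_oddCutPolytope hxQ
        (by rwa [compl_compl]) (by rwa [cut_compl]))

end Multigraph

/-! ### Cubic bridgeless graphs -/

open Classical in
/-- Every edge inside `S` is counted at both ends. -/
lemma Multigraph.sum_sum_cut_singleton {V E R : Type*} [Fintype E] [CommSemiring R]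
    {H : Multigraph V E} (hloop : ∀ e, H.src e ≠ H.tgt e) (z : E → R) (S : Finset V) :
    ∑ v ∈ S, ∑ e ∈ H.cut {v}, z e =
      ∑ e ∈ H.cut S, z e + 2 * ∑ e with H.src e ∈ S ∧ H.tgt e ∈ S, z e := by
  rw [sum_comm' (t' := univ) (s' := fun e => {v ∈ S | e ∈ H.cut {v}}) (by simp), cut, sum_filter,
    mul_sum, sum_filter, ← sum_add_distrib]
  refine sum_congr rfl fun e _ => ?_
  have h : {v ∈ S | e ∈ H.cut {v}} = ({H.src e, H.tgt e} : Finset V).filter (· ∈ S) := by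
    ext v
    have := hloop e
    simp only [mem_filter, mem_cut, mem_singleton, mem_insert]
    grind
  rw [h, sum_const, filter_insert, filter_singleton]
  by_cases hs : H.src e ∈ S <;> by_cases ht : H.tgt e ∈ S <;> simp [hs, ht, hloop e]

variable {V : Type*} {G : SimpleGraph V}

/-- A simple graph as a multigraph labelled by its own edges. -/
noncomputable def toMultigraph (G : SimpleGraph V) : Multigraph V G.edgeSet where
  src e := (Quot.out e.1).1
  tgt e := (Quot.out e.1).2

lemma mk_src_tgt_toMultigraph (e : G.edgeSet) :
    s((toMultigraph G).src e, (toMultigraph G).tgt e) = e :=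
  Quot.out_eq e.1

lemma adj_src_tgt_toMultigraph (e : G.edgeSet) :
    G.Adj ((toMultigraph G).src e) ((toMultigraph G).tgt e) := by
  rw [← SimpleGraph.mem_edgeSet, mk_src_tgt_toMultigraph]
  exact e.2

variable [Fintype G.edgeSet]

lemma mem_cut_singleton_toMultigraph {v : V} {e : G.edgeSet} :
    e ∈ (toMultigraph G).cut {v} ↔ v ∈ e.1 := by
  have hne := (adj_src_tgt_toMultigraph e).ne
  rw [← mk_src_tgt_toMultigraph e, Sym2.mem_iff, Multigraph.mem_cut, mem_singleton, mem_singleton]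
  grind

lemma card_cut_singleton_toMultigraph [Fintype V] [DecidableEq V] [DecidableRel G.Adj] (v : V) :
    #((toMultigraph G).cut {v}) = G.degree v := by
  rw [← G.card_incidenceFinset_eq_degree, ← card_map (Function.Embedding.subtype _)]
  congr 1
  ext e
  simp [-Multigraph.mem_cut, mem_cut_singleton_toMultigraph, SimpleGraph.incidenceSet, and_comm]

/-- A one-edge cut is a bridge. -/
lemma card_cut_toMultigraph_ne_one (hG : Bridgeless G) (S : Finset V) :
    #((toMultigraph G).cut S) ≠ 1 := by
  intro h
  obtain ⟨e, he⟩ := card_eq_one.1 h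
  have hcross (u v : V) (huv : G.Adj u v) (hu : u ∈ S) (hv : v ∉ S) : s(u, v) = e := by
    have : (⟨s(u, v), huv⟩ : G.edgeSet) ∈ (toMultigraph G).cut S := by
      have hst := mk_src_tgt_toMultigraph (⟨s(u, v), huv⟩ : G.edgeSet)
      dsimp only at hst
      rw [Sym2.eq_iff] at hst
      rcases hst with ⟨h1, h2⟩ | ⟨h1, h2⟩ <;> simp [h1, h2, hu, hv]
    rw [he, mem_singleton] at this
    rw [← this]
  have key (u v : V) (huv : s(u, v) = e) (hu : u ∈ S) (hv : v ∉ S) : False := by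
    refine hG e e.2 ?_
    rw [← huv, SimpleGraph.isBridge_iff]
    rintro ⟨p⟩
    obtain ⟨d, -, hd1, hd2⟩ := p.exists_boundary_dart (S : Set V) hu hv
    have hd := d.adj
    rw [SimpleGraph.deleteEdges_adj] at hd
    exact hd.2 ((hcross _ _ hd.1 hd1 hd2).trans huv.symm)
  have hmem : e ∈ (toMultigraph G).cut S := by simp [he]
  have hst := mk_src_tgt_toMultigraph e
  rw [Multigraph.mem_cut] at hmem
  by_cases hs : (toMultigraph G).src e ∈ S
  · exact key _ _ hst hs (by tauto)
  · exact key _ _ (Sym2.eq_swap.trans hst) (by tauto) hs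

/-- By parity every odd cut of a cubic graph is odd, so it has at least three edges unless it is a
bridge. -/
lemma const_third_mem_oddCutPolytope [Fintype V] [DecidableEq V] [DecidableRel G.Adj]
    (hcubic : G.IsRegularOfDegree 3) (hG : Bridgeless G) :
    (fun _ => 1 / 3) ∈ (toMultigraph G).oddCutPolytope := by
  refine ⟨fun e => by norm_num, fun e he => absurd he (adj_src_tgt_toMultigraph e).ne,
    fun v => ?_, fun S hS => ?_⟩
  · rw [sum_const, card_cut_singleton_toMultigraph, hcubic v]
    norm_num
  · have hcount := Multigraph.sum_sum_cut_singleton (H := toMultigraph G)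
      (fun e => (adj_src_tgt_toMultigraph e).ne) (fun _ => 1) S
    simp only [sum_const, smul_eq_mul, mul_one, card_cut_singleton_toMultigraph, hcubic _]
      at hcount
    have hne := card_cut_toMultigraph_ne_one hG S
    have h3 : 3 ≤ #((toMultigraph G).cut S) := by
      obtain ⟨k, hk⟩ := hS
      omega
    have h3 : (3 : ℝ) ≤ #((toMultigraph G).cut S) := by exact_mod_cast h3
    rw [sum_const, nsmul_eq_mul]
    linarith

lemma perfectMatchings_toMultigraph_subset :
    (toMultigraph G).perfectMatchings ⊆
      {a | ∃ S : Set G.edgeSet, G.lineGraph.IsIndepSet S ∧ a = S.indicator 1} := by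
  classical
  intro m hm
  refine ⟨{e | m e ≠ 0}, fun e he f hf hef hadj => ?_, ?_⟩
  · obtain ⟨-, v, hve, hvf⟩ := hadj
    exact hf (Multigraph.eq_zero_of_sum_eq_one hm.1 (hm.2.2 v)
      (mem_cut_singleton_toMultigraph.2 hve) (mem_cut_singleton_toMultigraph.2 hvf) he hef.symm)
  · ext e
    rcases hm.1 e with h | h <;> simp [h]

lemma const_third_mem_vertexPackingPolytope [Fintype V] [DecidableEq V] [DecidableRel G.Adj]
    (hcubic : G.IsRegularOfDegree 3) (hG : Bridgeless G) :
    (fun _ => 1 / 3) ∈ vertexPackingPolytope G.lineGraph :=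
  convexHull_mono perfectMatchings_toMultigraph_subset <|
    Multigraph.oddCutPolytope_subset_convexHull _ (const_third_mem_oddCutPolytope hcubic hG)

lemma sum_cut_le_one_of_mem_vertexPackingPolytope {a : G.edgeSet → ℝ}
    (ha : a ∈ vertexPackingPolytope G.lineGraph) (v : V) :
    ∑ e ∈ (toMultigraph G).cut {v}, a e ≤ 1 := by
  classical
  suffices h : vertexPackingPolytope G.lineGraph ⊆
      {a | ∑ e ∈ (toMultigraph G).cut {v}, a e ≤ 1} from h ha
  refine convexHull_min ?_ (convex_halfSpace_le ⟨fun x y => ?_, fun c x => ?_⟩ 1)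
  · rintro _ ⟨S, hS, rfl⟩
    simp only [Set.indicator_apply, Pi.one_apply, Set.mem_ofPred_eq, sum_boole]
    refine mod_cast card_le_one.2 fun e he f hf => ?_
    rw [mem_filter, mem_cut_singleton_toMultigraph] at he hf
    by_contra hef
    exact hS he.2 hf.2 hef ⟨hef, v, he.1, hf.1⟩
  · simp [sum_add_distrib]
  · simp [mul_sum]

/-- Summing the vertex constraints counts every edge twice, and a cubic graph has
`3 / 2` edges per vertex. -/
lemma sum_le_of_mem_vertexPackingPolytope [Fintype V] [DecidableEq V] [DecidableRel G.Adj]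
    (hcubic : G.IsRegularOfDegree 3) {a : G.edgeSet → ℝ}
    (ha : a ∈ vertexPackingPolytope G.lineGraph) :
    3 * ∑ e, a e ≤ Fintype.card G.edgeSet := by
  have key (z : G.edgeSet → ℝ) :
      ∑ v, ∑ e ∈ (toMultigraph G).cut {v}, z e = 2 * ∑ e, z e := by
    rw [Multigraph.sum_sum_cut_singleton fun e => (adj_src_tgt_toMultigraph e).ne]
    simp [Multigraph.cut]
  have h1 := key a
  have h2 := key fun _ => 1
  have h3 : ∑ v, ∑ e ∈ (toMultigraph G).cut {v}, a e ≤ ∑ _v : V, (1 : ℝ) :=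
    sum_le_sum fun v _ => sum_cut_le_one_of_mem_vertexPackingPolytope ha v
  simp only [sum_const, nsmul_eq_mul, mul_one, card_cut_singleton_toMultigraph, hcubic _,
    card_univ] at h2 h3
  push_cast at h2
  linarith

/-! ### Entropy bounds -/

section entropy

variable {W : Type*} {F : SimpleGraph W}

lemma nonneg_of_mem_vertexPackingPolytope {a : W → ℝ}
    (ha : a ∈ vertexPackingPolytope F) (w : W) : 0 ≤ a w := by
  suffices h : vertexPackingPolytope F ⊆ {a | 0 ≤ a} from h ha w
  refine convexHull_min ?_ (convex_Ici 0)
  rintro _ ⟨S, -, rfl⟩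
  exact Set.indicator_nonneg fun _ _ => zero_le_one

lemma logInv_of_ne_zero {t : ℝ} (ht : t ≠ 0) : logInv t = ENNReal.ofReal (-Real.logb 2 t) := by
  rw [logInv, if_neg ht, one_div, Real.logb_inv]

variable [Fintype W]

/-- A constant vector in the vertex packing polytope bounds the entropy for every
distribution. -/
lemma entropy_le_of_const_mem {c : ℝ} (hc : (fun _ => c) ∈ vertexPackingPolytope F) {P : W → ℝ}
    (hP : P ∈ stdSimplex ℝ W) : entropy F P ≤ logInv c := by
  refine (iInf₂_le _ hc).trans_eq ?_
  rw [← sum_mul, ← ENNReal.ofReal_sum_of_nonneg fun w _ => hP.1 w, hP.2, ENNReal.ofReal_one,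
    one_mul]

/-- If the coordinates have mean at most `c` throughout the polytope, Jensen's inequality, in the
form of the tangent to the logarithm at `c`, bounds the entropy of the uniform distribution. -/
lemma le_entropy_uniform [Nonempty W] {c : ℝ} (hc : 0 < c)
    (h : ∀ a ∈ vertexPackingPolytope F, ∑ w, a w ≤ c * Fintype.card W) :
    logInv c ≤ entropy F (uniform W) := by
  refine le_iInf₂ fun a ha => ?_
  have hcard : (0 : ℝ) < Fintype.card W := by exact_mod_cast Fintype.card_pos
  by_cases h0 : ∃ w, a w = 0
  · obtain ⟨w, hw⟩ := h0
    refine le_top.trans_eq (Eq.symm (ENNReal.sum_eq_top.2 ⟨w, mem_univ w, ?_⟩))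
    rw [logInv, if_pos hw, ENNReal.mul_top]
    simp [uniform]
  · push Not at h0
    have hpos (w : W) : 0 < a w := (nonneg_of_mem_vertexPackingPolytope ha w).lt_of_ne' (h0 w)
    simp only [logInv_of_ne_zero (h0 _), logInv_of_ne_zero hc.ne', uniform]
    simp_rw [← ENNReal.ofReal_mul (show (0 : ℝ) ≤ 1 / Fintype.card W by positivity)]
    refine le_trans (ENNReal.ofReal_le_ofReal ?_)
      (le_sum_of_subadditive ENNReal.ofReal ENNReal.ofReal_zero.le
        (fun _ _ => ENNReal.ofReal_add_le) _ _)
    rw [← mul_sum, one_div, inv_mul_eq_div, le_div_iff₀ hcard]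
    have htangent (w : W) : Real.log (a w) ≤ Real.log c + (a w / c - 1) := by
      have := Real.log_le_sub_one_of_pos (div_pos (hpos w) hc)
      rw [Real.log_div (h0 w) hc.ne'] at this
      linarith
    have hsum : ∑ w, Real.log (a w) ≤ Fintype.card W * Real.log c := by
      refine (sum_le_sum fun w _ => htangent w).trans ?_
      simp only [sum_add_distrib, sum_sub_distrib, sum_const, card_univ, nsmul_eq_mul, mul_one,
        ← sum_div]
      have := (div_le_iff₀' hc).2 (h a ha)
      linarith
    have hlog2 : 0 < Real.log 2 := Real.log_pos one_lt_two
    simp only [Real.logb, sum_neg_distrib, ← sum_div]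
    rw [neg_mul, neg_le_neg_iff, div_mul_eq_mul_div, mul_comm]
    gcongr

end entropy

end GraphEntropy

theorem mainTheorem4 {V : Type*} [Fintype V] [DecidableEq V] (G : SimpleGraph V)
    [DecidableRel G.Adj] (hcubic : G.IsRegularOfDegree 3)
    (hbridgeless : GraphEntropy.Bridgeless G) :
    GraphEntropy.IsSymmetric G.lineGraph := by
  intro P hP
  -- The simplex over an empty vertex set is empty.
  have : Nonempty G.edgeSet := by
    by_contra h
    rw [not_nonempty_iff] at h
    simpa using hP.2
  refine (GraphEntropy.entropy_le_of_const_mem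
    (GraphEntropy.const_third_mem_vertexPackingPolytope hcubic hbridgeless) hP).trans
    (GraphEntropy.le_entropy_uniform (by norm_num) fun a ha => ?_)
  have := GraphEntropy.sum_le_of_mem_vertexPackingPolytope hcubic ha
  linarith
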